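/- For $k\in\mathbb N$ and $r\ge -1/k$ let $g_k(r):=\mathbb P[\eta_1<0,\dots,\eta_k<0]$, where $(\eta_1,\dots,\eta_k)$ is a zero-mean Gaussian vector with $\operatorname{Cov}(\eta_i,\eta_j)=1+r$ if $i=j$ and $r$ if $i\ne j$; put $g_0:=1$. For a polyhedral cone $C\subset\mathbb R^N$ let $L(C)$ be its linear hull and let its solid angle be $\alpha(C):=\mathbb P[Z\in C]$, where $Z$ is a standard Gaussian vector on $L(C)$. For a nonempty face $F$ of $C$ let $T_F(C)=\{v\in\mathbb R^N: f_0+\varepsilon v\in C\text{ for some }\varepsilon>0\}$, with $f_0$ any point of the relative interior of $F$, be the tangent cone, and $N_F(C)=\{w\in\mathbb R^N:\langle w,v\rangle\le 0\text{ for all }v\in T_F(C)\}$ the normal cone. The $k$-th conic intrinsic volume of $C$ is $$\upsilon_k(C)=\sum_{F}\alpha(F)\,\alpha(N_F(C)),$$ the sum being over the $k$-dimensional faces $F$ of $C$. Let $n\ge 1$, let $r>-1/n$, and let $C_n(r)=\{\alpha_1u_1+\dots+\alpha_nu_n:\alpha_1,\dots,\alpha_n\ge 0\}$, where $u_1,\dots,u_n\in\mathbb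 R^N$ are any vectors with $\langle u_i,u_j\rangle=1+r$ if $i=j$ and $\langle u_i,u_j\rangle=r$ if $i\neq j$. Then, for every $k\in\{0,\dots,n\}$, $$\upsilon_k(C_n(r))=b_{n,k}(r):=\binom nk\, g_k\!\left(-\frac{r}{1+kr}\right) g_{n-k}\!\left(\frac{r}{1+kr}\right).$$ -/

import Mathlib

namespace ConicVolume

open MeasureTheory ProbabilityTheory
open scoped RealInnerProductSpace

/-- The `k × k` matrix with diagonal entries `1 + r` and off-diagonal entries `r`. -/
def equiCov (k : ℕ) (r : ℝ) : Matrix (Fin k) (Fin k) ℝ :=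
  Matrix.of fun i j => if i = j then 1 + r else r

/-- `g k r = P[η₁ < 0, …, η_k < 0]` for a zero-mean Gaussian vector `(η₁, …, η_k)` with covariance
matrix `equiCov k r`. It is meaningful for `r ≥ -1/k`, when that matrix is positive semidefinite.
For `k = 0` the condition is empty, and `g 0 r = 1`. -/
noncomputable def g (k : ℕ) (r : ℝ) : ℝ :=
  (multivariateGaussian (0 : EuclideanSpace ℝ (Fin k)) (equiCov k r)).real {x | ∀ i, x i < 0}

/-- `b_{n,k}(r) = C(n,k) g_k(-r/(1+kr)) g_{n-k}(r/(1+kr))` for `k ≤ n`; for `k > n` the binomial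
coefficient makes it zero. -/
noncomputable def b (n k : ℕ) (r : ℝ) : ℝ :=
  (n.choose k : ℝ) * g k (-(r / (1 + k * r))) * g (n - k) (r / (1 + k * r))

section Cones

variable {E : Type*} [NormedAddCommGroup E] [InnerProductSpace ℝ E]

/-- The cone `{α₁ u₁ + … + αₙ uₙ : α₁, …, αₙ ≥ 0}` spanned by `u₁, …, uₙ`. -/
def pos {n : ℕ} (u : Fin n → E) : Set E :=
  {x | ∃ a : Fin n → ℝ, (∀ i, 0 ≤ a i) ∧ x = ∑ i, a i • u i}

/-- The `k`-dimensional faces of a polyhedral set `P`: the nonempty sets of maximizers over `P` of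
a linear functional (`P` itself being given by the zero functional) whose affine hull has
dimension `k`. -/
def faces (P : Set E) (k : ℕ) : Set (Set E) :=
  {F | F.Nonempty ∧ IsExposed ℝ P F ∧ Module.finrank ℝ (vectorSpan ℝ F) = k}

/-- The tangent cone of `P` at its face `F`: the directions `v` with `f₀ + ε v ∈ P` for some
`ε > 0`, where `f₀` is a point of the relative interior of `F`; for convex `P` the choice of that
point makes no difference. -/
def tangentCone (P F : Set E) : Set E :=
  {v | ∃ f₀ ∈ intrinsicInterior ℝ F, ∃ ε : ℝ, 0 < ε ∧ f₀ + ε • v ∈ P}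

/-- The normal cone of `P` at its face `F`, the polar of the tangent cone. -/
def normalCone (P F : Set E) : Set E :=
  {w | ∀ v ∈ tangentCone P F, ⟪w, v⟫ ≤ 0}

variable [FiniteDimensional ℝ E] [MeasurableSpace E]

/-- The solid angle of the cone `C`, measured in its linear hull `L(C)`: the probability that a
standard Gaussian vector on `L(C)` falls in `C`. -/
noncomputable def solidAngle (C : Set E) : ℝ :=
  (stdGaussian (Submodule.span ℝ C)).real {z | (z : E) ∈ C}

/-- The `k`-th conic intrinsic volume of the polyhedral cone `C`, the sum over its (finitely many)
`k`-dimensional faces `F` of the solid angle of `F` times that of the normal cone at `F`. -/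
noncomputable def conicIntrinsicVolume (k : ℕ) (C : Set E) : ℝ :=
  ∑ᶠ F ∈ faces C k, solidAngle F * solidAngle (normalCone C F)

end Cones

end ConicVolume

/-! Since `1 + n * r > 0`, the generators have a biorthogonal family (`inner_dualVec_univ`), so the
cone is simplicial and its `k`-faces correspond to the `k`-subsets `s` of the generators
(`faces_pos`). Inside its linear hull, each face and each normal cone is cut out by inequalities `⟪w
i, z⟫ ≤ 0` whose normals are again equicorrelated. For the face, the normals are the negated dual
basis, with parameter `-r/(1+kr)`; for the normal cone, they are the projections of the remaining `u
j` orthogonal to the face, with parameter `r/(1+kr)` (`inner_dualVec_dualVec`). The covariance of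
the variables `⟪w i, Z⟫` is the Gram matrix of the `w i`, so both angles are values of `g`
(`solidAngle_eq_g`). They depend on `s` only through its size, whence the binomial factor. -/

namespace ConicVolume

open MeasureTheory ProbabilityTheory
open scoped RealInnerProductSpace

/-! ### Gaussian measure of an intersection of half-spaces -/

section Gaussian

variable {H : Type*} [NormedAddCommGroup H] [InnerProductSpace ℝ H]

/-- The linear map sending `z` to the vector of its inner products with `v₁, …, v_m`. -/
noncomputable def innerMap {m : ℕ} (v : Fin m → H) : H →L[ℝ] EuclideanSpace ℝ (Fin m) :=
  (EuclideanSpace.equiv (Fin m) ℝ).symm.toContinuousLinearMap ∘L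
    ContinuousLinearMap.pi fun i => innerSL ℝ (v i)

@[simp]
theorem innerMap_apply {m : ℕ} (v : Fin m → H) (z : H) (i : Fin m) :
    innerMap v z i = ⟪v i, z⟫ := rfl

theorem posSemidef_of_inner_eq {m : ℕ} {v : Fin m → H} {S : Matrix (Fin m) (Fin m) ℝ}
    (hv : ∀ i j, ⟪v i, v j⟫ = S i j) : S.PosSemidef := by
  have : S = Matrix.gram ℝ v := by
    ext i j
    simp [Matrix.gram, hv]
  rw [this]
  exact Matrix.posSemidef_gram ℝ v

variable [FiniteDimensional ℝ H] [MeasurableSpace H] [BorelSpace H]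

/-- Both measures are Gaussian, so it suffices to compare means and, on coordinate vectors,
covariances. -/
theorem map_innerMap_stdGaussian {m : ℕ} {v : Fin m → H} {S : Matrix (Fin m) (Fin m) ℝ}
    (hv : ∀ i j, ⟪v i, v j⟫ = S i j) :
    (stdGaussian H).map (innerMap v) = multivariateGaussian 0 S := by
  have hS := posSemidef_of_inner_eq hv
  apply IsGaussian.ext
  · simp only [id_eq, integral_id_multivariateGaussian]
    rw [ContinuousLinearMap.integral_id_map, integral_id_stdGaussian, map_zero]
    exact IsGaussian.integrable_id
  rw [← ContinuousLinearMap.toBilinForm_inj]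
  refine LinearMap.BilinForm.ext_basis (EuclideanSpace.basisFun (Fin m) ℝ).toBasis fun i j ↦ ?_
  rw [ContinuousLinearMap.toBilinForm_apply, ContinuousLinearMap.toBilinForm_apply,
    covarianceBilin_apply_eq_cov IsGaussian.memLp_two_id, covariance_map]
  · have (i : Fin m) : (fun y ↦ ⟪(EuclideanSpace.basisFun (Fin m) ℝ).toBasis i, y⟫) ∘
        innerMap v = fun z ↦ ⟪v i, z⟫ := by
      ext
      simp [PiLp.inner_apply]
    simp_rw [this, covarianceBilin_multivariateGaussian hS]
    rw [← covarianceBilin_apply_eq_cov IsGaussian.memLp_two_id, covarianceBilin_stdGaussian]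
    simpa [innerSL_apply_apply ℝ] using hv i j
  any_goals exact Measurable.aestronglyMeasurable (by fun_prop)
  · fun_prop

theorem stdGaussian_inner_eq_zero {v : H} (hv : v ≠ 0) :
    stdGaussian H {z | ⟪v, z⟫ = 0} = 0 := by
  have h := IsGaussian.map_eq_gaussianReal (μ := stdGaussian H) (innerSL ℝ v)
  rw [variance_dual_stdGaussian, innerSL_apply_norm] at h
  have hne : (‖v‖ ^ 2).toNNReal ≠ 0 := by
    simpa using hv
  have := nullSingletonClass_gaussianReal (μ := (stdGaussian H)[innerSL ℝ v]) hne
  have h0 : (stdGaussian H).map (innerSL ℝ v) {0} = 0 := by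
    rw [h, measure_singleton]
  rwa [Measure.map_apply (by fun_prop) (measurableSet_singleton 0)] at h0

/-- The hyperplanes orthogonal to the nonzero `v i` are null sets, so weak and strict inequalities
have the same probability. -/
theorem stdGaussian_real_inner_nonpos {m : ℕ} {ρ : ℝ} {v : Fin m → H}
    (h0 : ∀ i, v i ≠ 0)
    (hv : ∀ i j, ⟪v i, v j⟫ = equiCov m ρ i j) :
    (stdGaussian H).real {z | ∀ i, ⟪v i, z⟫ ≤ 0} = g m ρ := by
  have hms : MeasurableSet {x : EuclideanSpace ℝ (Fin m) | ∀ i, x i < 0} := by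
    rw [Set.ofPred_forall]
    exact MeasurableSet.iInter fun i => measurableSet_lt (by fun_prop) (by fun_prop)
  rw [g, ← map_innerMap_stdGaussian hv, measureReal_def, measureReal_def,
    Measure.map_apply (by fun_prop) hms]
  congr 1
  apply measure_congr
  have hne : ∀ᵐ z ∂(stdGaussian H), ∀ i, ⟪v i, z⟫ ≠ 0 := by
    rw [ae_all_iff]
    intro i
    rw [ae_iff]
    simpa using stdGaussian_inner_eq_zero (h0 i)
  filter_upwards [hne] with z hz
  apply propext
  exact forall_congr' fun i => ⟨fun h => lt_of_le_of_ne h (hz i), fun h => le_of_lt h⟩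

end Gaussian

/-! ### Solid angles from half-space descriptions -/

section SolidAngle

variable {E : Type*} [NormedAddCommGroup E] [InnerProductSpace ℝ E] [FiniteDimensional ℝ E]
  [MeasurableSpace E] [BorelSpace E]

theorem solidAngle_eq_g {C : Set E} {m : ℕ} {ρ : ℝ} (w : Fin m → E) (h0 : ∀ i, w i ≠ 0)
    (hw : ∀ i, w i ∈ Submodule.span ℝ C) (hgram : ∀ i j, ⟪w i, w j⟫ = equiCov m ρ i j)
    (hC : ∀ z ∈ Submodule.span ℝ C, z ∈ C ↔ ∀ i, ⟪w i, z⟫ ≤ 0) :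
    solidAngle C = g m ρ := by
  rw [solidAngle, ← stdGaussian_real_inner_nonpos
    (v := fun i => (⟨w i, hw i⟩ : Submodule.span ℝ C))
    (fun i h => h0 i (congrArg Subtype.val h)) hgram]
  congr 1
  ext z
  exact hC z z.2

end SolidAngle

/-! ### Faces, tangent cones and normal cones of a simplicial cone -/

section SimplicialCone

variable {E : Type*} [NormedAddCommGroup E] [InnerProductSpace ℝ E] {n : ℕ}

/-- The cone spanned by the vectors `u i` with `i ∈ s`. -/
def subcone (u : Fin n → E) (s : Finset (Fin n)) : Set E :=
  {x | ∃ a : Fin n → ℝ, (∀ i, 0 ≤ a i) ∧ (∀ i ∉ s, a i = 0) ∧ x = ∑ i, a i • u i}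

variable {u d : Fin n → E} {s : Finset (Fin n)}

theorem zero_mem_subcone : (0 : E) ∈ subcone u s :=
  ⟨0, by simp, by simp, by simp⟩

theorem mem_subcone {i : Fin n} (hi : i ∈ s) : u i ∈ subcone u s := by
  refine ⟨Pi.single i 1, fun j => ?_, fun j hj => ?_, ?_⟩
  · by_cases h : j = i
    · subst h; simp
    · simp [h]
  · have : j ≠ i := fun h => hj (h ▸ hi)
    simp [this]
  · simp [Pi.single_apply]

theorem subcone_subset_pos : subcone u s ⊆ pos u :=
  fun _ ⟨a, ha, _, hx⟩ => ⟨a, ha, hx⟩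

theorem zero_mem_pos : (0 : E) ∈ pos u := ⟨0, by simp, by simp⟩

theorem mem_pos (i : Fin n) : u i ∈ pos u :=
  subcone_subset_pos (mem_subcone (Finset.mem_univ i))

theorem add_mem_pos {x y : E} (hx : x ∈ pos u) (hy : y ∈ pos u) : x + y ∈ pos u := by
  obtain ⟨a, ha, rfl⟩ := hx
  obtain ⟨c, hc, rfl⟩ := hy
  exact ⟨a + c, fun i => add_nonneg (ha i) (hc i), by simp [add_smul, Finset.sum_add_distrib]⟩

theorem span_subcone : Submodule.span ℝ (subcone u s) = Submodule.span ℝ (u '' s) := by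
  apply le_antisymm
  · rw [Submodule.span_le]
    rintro x ⟨a, -, h0, rfl⟩
    refine Submodule.sum_mem _ fun i _ => ?_
    by_cases hi : i ∈ s
    · exact Submodule.smul_mem _ _ (Submodule.subset_span ⟨i, hi, rfl⟩)
    · simp [h0 i hi]
  · apply Submodule.span_mono
    rintro _ ⟨i, hi, rfl⟩
    exact mem_subcone hi

theorem vectorSpan_subcone : vectorSpan ℝ (subcone u s) = Submodule.span ℝ (u '' s) := by
  rw [← span_subcone, vectorSpan_eq_span_vsub_set_right ℝ (zero_mem_subcone (u := u) (s := s))]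
  simp_rw [vsub_eq_sub, sub_zero, Set.image_id']

theorem inner_sum_smul (hd : ∀ i j, ⟪d i, u j⟫ = if i = j then 1 else 0) (a : Fin n → ℝ)
    (i : Fin n) : ⟪d i, ∑ j, a j • u j⟫ = a i := by
  simp [inner_sum, inner_smul_right, hd]

theorem linearIndependent_of_biorthogonal (hd : ∀ i j, ⟪d i, u j⟫ = if i = j then 1 else 0) :
    LinearIndependent ℝ u := by
  rw [Fintype.linearIndependent_iff]
  intro a h i
  rw [← inner_sum_smul hd a i, h, inner_zero_right]

theorem finrank_vectorSpan_subcone (hd : ∀ i j, ⟪d i, u j⟫ = if i = j then 1 else 0) :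
    Module.finrank ℝ (vectorSpan ℝ (subcone u s)) = s.card := by
  have h := (linearIndependent_of_biorthogonal hd).comp ((↑) : s → Fin n) Subtype.val_injective
  have hr : Set.range (u ∘ ((↑) : s → Fin n)) = u '' s := by
    ext
    simp
  rw [vectorSpan_subcone, ← hr, finrank_span_eq_card h, Fintype.card_coe]

theorem mem_subcone_iff (hd : ∀ i j, ⟪d i, u j⟫ = if i = j then 1 else 0) (i : Fin n) :
    u i ∈ subcone u s ↔ i ∈ s := by
  refine ⟨?_, mem_subcone⟩
  rintro ⟨a, -, h0, hx⟩
  by_contra hi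
  have := inner_sum_smul hd a i
  rw [← hx, hd, h0 i hi] at this
  simp at this

theorem subcone_injective (hd : ∀ i j, ⟪d i, u j⟫ = if i = j then 1 else 0) :
    Function.Injective (subcone u) := by
  intro s t h
  ext i
  rw [← mem_subcone_iff hd, h, mem_subcone_iff hd]

/-- The exposing functional is minus the sum of the coordinates outside `s`. -/
theorem isExposed_subcone (hd : ∀ i j, ⟪d i, u j⟫ = if i = j then 1 else 0) :
    IsExposed ℝ (pos u) (subcone u s) := by
  intro _
  have hl : ∀ a : Fin n → ℝ,
      innerSL ℝ (-∑ j ∈ sᶜ, d j) (∑ i, a i • u i) = -∑ j ∈ sᶜ, a j := by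
    intro a
    rw [innerSL_apply_apply, inner_neg_left, sum_inner]
    simp_rw [inner_sum_smul hd]
  refine ⟨innerSL ℝ (-∑ j ∈ sᶜ, d j), ?_⟩
  ext x
  constructor
  · rintro ⟨a, ha, h0, rfl⟩
    refine ⟨⟨a, ha, rfl⟩, ?_⟩
    rintro _ ⟨c, hc, rfl⟩
    rw [hl, hl, Finset.sum_eq_zero (f := a) fun i hi => h0 i (by simpa using hi), neg_zero,
      neg_nonpos]
    exact Finset.sum_nonneg fun i _ => hc i
  · rintro ⟨⟨a, ha, rfl⟩, hmax⟩
    refine ⟨a, ha, fun i hi => ?_, rfl⟩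
    have h := hmax 0 zero_mem_pos
    rw [hl, map_zero, le_neg, neg_zero] at h
    exact (Finset.sum_eq_zero_iff_of_nonneg fun i _ => ha i).1
      (le_antisymm h (Finset.sum_nonneg fun i _ => ha i)) i (by simpa using hi)

/-- A functional attaining its maximum on the cone is nonpositive on each generator, so its maximum
is `0`, and a maximizer uses only generators on which it vanishes. -/
theorem exists_eq_subcone {F : Set E} (hne : F.Nonempty) (hF : IsExposed ℝ (pos u) F) :
    ∃ s, F = subcone u s := by
  classical
  obtain ⟨l, hl⟩ := hF hne
  obtain ⟨x₀, hx₀⟩ := hne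
  rw [hl] at hx₀
  have hle : ∀ i, l (u i) ≤ 0 := by
    intro i
    have := hx₀.2 _ (add_mem_pos hx₀.1 (mem_pos i))
    rw [map_add] at this
    linarith
  have hval : ∀ a : Fin n → ℝ, l (∑ i, a i • u i) = ∑ i, a i * l (u i) := by
    intro a
    simp [map_sum]
  refine ⟨Finset.univ.filter fun i => l (u i) = 0, ?_⟩
  rw [hl]
  ext x
  constructor
  · rintro ⟨⟨a, ha, rfl⟩, hmax⟩
    refine ⟨a, ha, fun i hi => ?_, rfl⟩
    have h := hmax 0 zero_mem_pos
    rw [hval, map_zero] at h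
    have hnp : ∀ i ∈ Finset.univ, a i * l (u i) ≤ 0 :=
      fun i _ => mul_nonpos_of_nonneg_of_nonpos (ha i) (hle i)
    have := (Finset.sum_eq_zero_iff_of_nonpos hnp).1
      (le_antisymm (Finset.sum_nonpos hnp) h) i (Finset.mem_univ i)
    simpa using (mul_eq_zero.1 this).resolve_right (by simpa using hi)
  · rintro ⟨a, ha, h0, rfl⟩
    refine ⟨⟨a, ha, rfl⟩, ?_⟩
    rintro _ ⟨c, hc, rfl⟩
    rw [hval, hval, Finset.sum_eq_zero (f := fun i => a i * l (u i))]
    · exact Finset.sum_nonpos fun i _ => mul_nonpos_of_nonneg_of_nonpos (hc i) (hle i)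
    · intro i _
      by_cases hi : l (u i) = 0
      · simp [hi]
      · simp [h0 i (by simpa using hi)]

theorem faces_pos (hd : ∀ i j, ⟪d i, u j⟫ = if i = j then 1 else 0) (k : ℕ) :
    faces (pos u) k = subcone u '' (Finset.powersetCard k (Finset.univ : Finset (Fin n))) := by
  ext F
  constructor
  · rintro ⟨hne, hF, hk⟩
    obtain ⟨s, rfl⟩ := exists_eq_subcone hne hF
    rw [finrank_vectorSpan_subcone hd] at hk
    exact ⟨s, by simp [Finset.mem_powersetCard, hk], rfl⟩
  · rintro ⟨s, hs, rfl⟩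
    refine ⟨⟨0, zero_mem_subcone⟩, isExposed_subcone hd, ?_⟩
    rw [finrank_vectorSpan_subcone hd]
    simpa [Finset.mem_powersetCard] using hs

theorem sum_mem_intrinsicInterior_subcone (hd : ∀ i j, ⟪d i, u j⟫ = if i = j then 1 else 0) :
    ∑ i ∈ s, u i ∈ intrinsicInterior ℝ (subcone u s) := by
  have hsum : ∑ i ∈ s, u i = ∑ i, (if i ∈ s then (1 : ℝ) else 0) • u i := by
    simp [ite_smul, Finset.sum_ite_mem]
  have hmem : ∑ i ∈ s, u i ∈ subcone u s :=
    ⟨fun i => if i ∈ s then 1 else 0, fun i => by positivity, fun i hi => by simp [hi], hsum⟩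
  rw [mem_intrinsicInterior]
  refine ⟨⟨_, subset_affineSpan ℝ _ hmem⟩, ?_, rfl⟩
  rw [mem_interior]
  -- Pairing with `d i` reads off the `i`-th coordinate; strict positivity of the coordinates in `s`
  -- is an open condition.
  refine ⟨{x | ∀ i ∈ s, 0 < ⟪d i, (x : E)⟫}, ?_, ?_, ?_⟩
  · rintro ⟨x, hx⟩ hpos
    have hx' : x ∈ Submodule.span ℝ (u '' s) := by
      rw [← span_subcone]
      exact affineSpan_subset_span hx
    obtain ⟨c, rfl⟩ := (Submodule.mem_span_image_finset_iff_exists_fun' ℝ).1 hx'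
    have hc : ∑ i ∈ s, c i • u i = ∑ i, (if i ∈ s then c i else 0) • u i := by
      simp [ite_smul, Finset.sum_ite_mem]
    refine ⟨fun i => if i ∈ s then c i else 0, fun i => ?_, fun i hi => by simp [hi], hc⟩
    by_cases hi : i ∈ s
    · have := hpos i hi
      simp only [hc, inner_sum_smul hd] at this
      exact this.le
    · simp [hi]
  · have : {x : affineSpan ℝ (subcone u s) | ∀ i ∈ s, 0 < ⟪d i, (x : E)⟫} =
        ⋂ i ∈ s, {x : affineSpan ℝ (subcone u s) | 0 < ⟪d i, (x : E)⟫} := by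
      ext x
      simp
    rw [this]
    exact isOpen_biInter_finset fun i _ => isOpen_lt (by fun_prop) (by fun_prop)
  · intro i hi
    change 0 < ⟪d i, ∑ i ∈ s, u i⟫
    rw [hsum, inner_sum_smul hd, if_pos hi]
    exact zero_lt_one

theorem tangentCone_subcone (hd : ∀ i j, ⟪d i, u j⟫ = if i = j then 1 else 0) :
    tangentCone (pos u) (subcone u s) =
      {v | ∃ a : Fin n → ℝ, (∀ i ∉ s, 0 ≤ a i) ∧ v = ∑ i, a i • u i} := by
  ext v
  constructor
  · rintro ⟨f, hf, ε, hε, a, ha, hv⟩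
    obtain ⟨c, -, h0, rfl⟩ := intrinsicInterior_subset hf
    refine ⟨fun i => ε⁻¹ * (a i - c i), fun i hi => ?_, ?_⟩
    · simp only [h0 i hi, sub_zero]
      exact mul_nonneg (inv_nonneg.2 hε.le) (ha i)
    · simp_rw [mul_smul, ← Finset.smul_sum, sub_smul, Finset.sum_sub_distrib, ← hv]
      rw [add_sub_cancel_left, inv_smul_smul₀ hε.ne']
  · rintro ⟨a, ha, rfl⟩
    have hA : 0 < 1 + ∑ i, |a i| := by positivity
    -- This step size `ε` satisfies `ε * |a i| ≤ 1`, so the coordinates `1 + ε * a i` with `i ∈ s`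
    -- stay nonnegative.
    refine ⟨_, sum_mem_intrinsicInterior_subcone hd, (1 + ∑ i, |a i|)⁻¹, inv_pos.2 hA,
      fun i => (if i ∈ s then 1 else 0) + (1 + ∑ i, |a i|)⁻¹ * a i, fun i => ?_, ?_⟩
    · by_cases hi : i ∈ s
      · have h1 : |a i| ≤ ∑ i, |a i| :=
          Finset.single_le_sum (f := fun i => |a i|) (fun i _ => abs_nonneg _) (Finset.mem_univ i)
        have h2 := neg_abs_le (a i)
        have h3 : (1 + ∑ i, |a i|)⁻¹ * (1 + ∑ i, |a i|) = 1 := inv_mul_cancel₀ hA.ne'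
        have h4 : 0 ≤ (1 + ∑ i, |a i|)⁻¹ * (1 + ∑ i, |a i| + a i) :=
          mul_nonneg (inv_pos.2 hA).le (by linarith)
        simp only [hi, if_true]
        linarith [mul_add (1 + ∑ i, |a i|)⁻¹ (1 + ∑ i, |a i|) (a i)]
      · simp only [hi, if_false, zero_add]
        exact mul_nonneg (inv_pos.2 hA).le (ha i hi)
    · simp [add_smul, Finset.sum_add_distrib, mul_smul, Finset.smul_sum, ite_smul,
        Finset.sum_ite_mem]

theorem normalCone_subcone (hd : ∀ i j, ⟪d i, u j⟫ = if i = j then 1 else 0) :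
    normalCone (pos u) (subcone u s) =
      {w | (∀ i ∈ s, ⟪u i, w⟫ = 0) ∧ ∀ i ∉ s, ⟪u i, w⟫ ≤ 0} := by
  ext w
  simp only [normalCone, tangentCone_subcone hd, Set.mem_ofPred_eq]
  constructor
  · intro h
    have key : ∀ (i : Fin n) (t : ℝ), (i ∉ s → 0 ≤ t) → t * ⟪u i, w⟫ ≤ 0 := by
      intro i t ht
      have := h (t • u i) ⟨Pi.single i t, fun j hj => ?_, by simp [Pi.single_apply, ite_smul]⟩
      · rwa [inner_smul_right, real_inner_comm] at this
      · by_cases hji : j = i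
        · subst hji; simpa using ht hj
        · simp [hji]
    refine ⟨fun i hi => ?_, fun i hi => ?_⟩
    · have h1 := key i 1 (absurd hi)
      have h2 := key i (-1) (absurd hi)
      linarith
    · simpa using key i 1 fun _ => zero_le_one
  · rintro ⟨h0, hle⟩ _ ⟨a, ha, rfl⟩
    rw [inner_sum]
    refine Finset.sum_nonpos fun i _ => ?_
    rw [inner_smul_right, real_inner_comm]
    by_cases hi : i ∈ s
    · simp [h0 i hi]
    · exact mul_nonpos_of_nonneg_of_nonpos (ha i hi) (hle i hi)

theorem mem_span_normalCone_subcone (hd : ∀ i j, ⟪d i, u j⟫ = if i = j then 1 else 0) {w : E} :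
    w ∈ Submodule.span ℝ (normalCone (pos u) (subcone u s)) ↔ ∀ i ∈ s, ⟪u i, w⟫ = 0 := by
  rw [normalCone_subcone hd]
  constructor
  · intro hw i hi
    induction hw using Submodule.span_induction with
    | mem x hx => exact hx.1 i hi
    | zero => simp
    | add x y _ _ hx hy => rw [inner_add_right, hx, hy, add_zero]
    | smul t x _ hx => rw [inner_smul_right, hx, mul_zero]
  · intro hw
    have hu : ∀ i (t : ℝ), ⟪u i, t • ∑ j ∈ sᶜ, d j⟫ = if i ∈ s then 0 else t := by
      intro i t
      rw [inner_smul_right, inner_sum]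
      simp_rw [fun j => real_inner_comm (d j) (u i), hd]
      by_cases hi : i ∈ s <;> simp [hi]
    set t : ℝ := ∑ i, |⟪u i, w⟫|
    have ht : ∀ i, ⟪u i, w⟫ ≤ t := fun i => (le_abs_self _).trans
      (Finset.single_le_sum (f := fun i => |⟪u i, w⟫|) (fun i _ => abs_nonneg _)
        (Finset.mem_univ i))
    have ht0 : 0 ≤ t := Finset.sum_nonneg fun i _ => abs_nonneg _
    -- Both terms of this difference lie in the normal cone: `t` is nonnegative and dominates every
    -- `⟪u i, w⟫`.
    have : w = (w - t • ∑ j ∈ sᶜ, d j) - (-t) • ∑ j ∈ sᶜ, d j := by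
      rw [neg_smul]; abel
    rw [this]
    refine Submodule.sub_mem _ (Submodule.subset_span ⟨fun i hi => ?_, fun i hi => ?_⟩)
      (Submodule.subset_span ⟨fun i hi => ?_, fun i hi => ?_⟩)
    · rw [inner_sub_right, hw i hi, hu, if_pos hi, sub_zero]
    · rw [inner_sub_right, hu, if_neg hi]
      linarith [ht i]
    · rw [hu, if_pos hi]
    · rw [hu, if_neg hi]
      linarith

end SimplicialCone

/-! ### Equicorrelated generators -/

section Equicorrelated

variable {E : Type*} [NormedAddCommGroup E] [InnerProductSpace ℝ E] {n : ℕ}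

theorem one_add_mul_pos {r : ℝ} (hn : 1 ≤ n) (hr : -1 / (n : ℝ) < r) {k : ℕ} (hk : k ≤ n) :
    0 < 1 + k * r := by
  have hn0 : (0 : ℝ) < n := by exact_mod_cast hn
  have h1 : -1 < r * n := (div_lt_iff₀ hn0).1 hr
  have hk' : (k : ℝ) ≤ n := by exact_mod_cast hk
  rcases le_or_gt 0 r with h | h
  · positivity
  · nlinarith

/-- The vectors `u j - r / (1 + |s| r) • ∑ i ∈ s, u i`. When the Gram matrix of `u` is
`equiCov n r`, those with `j ∈ s` form the dual basis of `u i`, `i ∈ s`, in the span of the latter,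
and those with `j ∉ s` are the projections of `u j` to the orthogonal complement of that span. -/
noncomputable def dualVec (u : Fin n → E) (r : ℝ) (s : Finset (Fin n)) (j : Fin n) : E :=
  u j - (r / (1 + s.card * r)) • ∑ i ∈ s, u i

variable {u : Fin n → E} {r : ℝ} {s : Finset (Fin n)}

theorem inner_sum_of_gram (hu : ∀ i j, ⟪u i, u j⟫ = if i = j then 1 + r else r) (j : Fin n) :
    ⟪∑ i ∈ s, u i, u j⟫ = (if j ∈ s then 1 else 0) + s.card * r := by
  have : ∀ i, ⟪u i, u j⟫ = (if i = j then 1 else 0) + r := by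
    intro i
    rw [hu]
    split_ifs <;> ring
  simp_rw [sum_inner, this, Finset.sum_add_distrib]
  simp

theorem inner_dualVec (hu : ∀ i j, ⟪u i, u j⟫ = if i = j then 1 + r else r)
    (hs : 1 + s.card * r ≠ 0) (j i : Fin n) :
    ⟪dualVec u r s j, u i⟫ =
      (if j = i then 1 else 0) + if i ∈ s then 0 else r / (1 + s.card * r) := by
  have hc := div_mul_cancel₀ r hs
  rw [dualVec, inner_sub_left, real_inner_smul_left, inner_sum_of_gram hu, hu]
  split_ifs <;> linear_combination -hc

theorem inner_dualVec_of_mem (hu : ∀ i j, ⟪u i, u j⟫ = if i = j then 1 + r else r)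
    (hs : 1 + s.card * r ≠ 0) (j : Fin n) {i : Fin n} (hi : i ∈ s) :
    ⟪dualVec u r s j, u i⟫ = if j = i then 1 else 0 := by
  rw [inner_dualVec hu hs, if_pos hi, add_zero]

theorem inner_dualVec_sum (hu : ∀ i j, ⟪u i, u j⟫ = if i = j then 1 + r else r)
    (hs : 1 + s.card * r ≠ 0) (j : Fin n) (c : Fin n → ℝ) :
    ⟪dualVec u r s j, ∑ i ∈ s, c i • u i⟫ = if j ∈ s then c j else 0 := by
  rw [inner_sum, Finset.sum_congr rfl fun i hi => by
    rw [inner_smul_right, inner_dualVec_of_mem hu hs j hi]]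
  simp

/-- The two corrections cancel when exactly one index is in `s`; otherwise they leave `-r/(1+|s|r)`
inside `s` and `+r/(1+|s|r)` outside. -/
theorem inner_dualVec_dualVec (hu : ∀ i j, ⟪u i, u j⟫ = if i = j then 1 + r else r)
    (hs : 1 + s.card * r ≠ 0) (j l : Fin n) :
    ⟪dualVec u r s j, dualVec u r s l⟫ =
      (if j = l then 1 else 0) + (if l ∈ s then 0 else r / (1 + s.card * r)) -
        if j ∈ s then r / (1 + s.card * r) else 0 := by
  have h := inner_dualVec_sum hu hs j fun _ => 1
  simp only [one_smul] at h
  conv_lhs => rw [dualVec.eq_def u r s l]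
  rw [inner_sub_right, inner_smul_right, inner_dualVec hu hs, h]
  split_ifs <;> ring

theorem inner_dualVec_of_orthogonal {j : Fin n} {z : E} (hz : ∀ i ∈ s, ⟪u i, z⟫ = 0) :
    ⟪dualVec u r s j, z⟫ = ⟪u j, z⟫ := by
  rw [dualVec, inner_sub_left, real_inner_smul_left, sum_inner, Finset.sum_eq_zero hz, mul_zero,
    sub_zero]

theorem dualVec_ne_zero (hu : ∀ i j, ⟪u i, u j⟫ = if i = j then 1 + r else r)
    (hs : 1 + s.card * r ≠ 0) {j : Fin n} (hj : j ∈ s) : dualVec u r s j ≠ 0 := by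
  intro h
  have := inner_dualVec_of_mem hu hs j hj
  simp [h] at this

theorem inner_dualVec_univ (hu : ∀ i j, ⟪u i, u j⟫ = if i = j then 1 + r else r)
    (hn : 1 + n * r ≠ 0) (i j : Fin n) :
    ⟪dualVec u r Finset.univ i, u j⟫ = if i = j then 1 else 0 :=
  inner_dualVec_of_mem hu (by simpa using hn) i (Finset.mem_univ j)

theorem dualVec_ne_zero_of_notMem (hu : ∀ i j, ⟪u i, u j⟫ = if i = j then 1 + r else r)
    (hn : 1 + n * r ≠ 0) {j : Fin n} (hj : j ∉ s) : dualVec u r s j ≠ 0 := by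
  intro h
  have hd := inner_dualVec_univ hu hn j
  -- As `j ∉ s`, the coefficient of `u j` in `dualVec u r s j` is `1`; the full dual basis extracts
  -- it.
  have : ⟪dualVec u r Finset.univ j, dualVec u r s j⟫ = 1 := by
    rw [dualVec.eq_def u r s j, inner_sub_right, inner_smul_right, inner_sum,
      Finset.sum_eq_zero, hd]
    · simp
    · intro i hi
      rw [hd, if_neg]
      rintro rfl
      exact hj hi
  simp [h] at this

variable [FiniteDimensional ℝ E] [MeasurableSpace E] [BorelSpace E]

theorem solidAngle_subcone (hu : ∀ i j, ⟪u i, u j⟫ = if i = j then 1 + r else r)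
    {k : ℕ} (hk : s.card = k) (hs : 1 + k * r ≠ 0) :
    solidAngle (subcone u s) = g k (-(r / (1 + k * r))) := by
  subst hk
  let e := s.orderIsoOfFin rfl
  -- The sign turns nonnegative coordinates into nonpositive inner products; the Gram matrix is
  -- unaffected.
  refine solidAngle_eq_g (fun i => -dualVec u r s (e i))
    (fun i => neg_ne_zero.2 (dualVec_ne_zero hu hs (e i).2)) (fun i => ?_) (fun i j => ?_)
    fun z hz => ?_
  · rw [span_subcone]
    exact Submodule.neg_mem _ <| Submodule.sub_mem _ (Submodule.subset_span ⟨_, (e i).2, rfl⟩) <|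
      Submodule.smul_mem _ _ <| Submodule.sum_mem _ fun l hl => Submodule.subset_span ⟨l, hl, rfl⟩
  · rw [inner_neg_neg, inner_dualVec_dualVec hu hs]
    by_cases hij : i = j
    · subst hij
      simp [equiCov]
      ring
    · have : (e i : Fin n) ≠ e j := fun h => hij (e.injective (Subtype.ext h))
      simp [equiCov, hij, this]
  · rw [span_subcone] at hz
    obtain ⟨c, rfl⟩ := (Submodule.mem_span_image_finset_iff_exists_fun' ℝ).1 hz
    have hiff : (∀ i, ⟪-dualVec u r s (e i), ∑ i ∈ s, c i • u i⟫ ≤ 0) ↔ ∀ j ∈ s, 0 ≤ c j := by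
      simp_rw [inner_neg_left, inner_dualVec_sum hu hs]
      constructor
      · intro h j hj
        simpa [hj] using h (e.symm ⟨j, hj⟩)
      · intro h i
        simpa using h _ (e i).2
    rw [hiff]
    constructor
    · rintro ⟨a, ha, h0, hx⟩ j hj
      have hx' : ∑ i ∈ s, c i • u i = ∑ i ∈ s, a i • u i := by
        rw [hx]
        exact (Finset.sum_subset (Finset.subset_univ s) fun i _ hi => by simp [h0 i hi]).symm
      have := inner_dualVec_sum hu hs j c
      rw [hx', inner_dualVec_sum hu hs, if_pos hj, if_pos hj] at this
      exact this ▸ ha j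
    · intro h
      refine ⟨fun i => if i ∈ s then c i else 0, fun i => ?_, fun i hi => by simp [hi], ?_⟩
      · by_cases hi : i ∈ s <;> simp [hi, h]
      · simp [ite_smul, Finset.sum_ite_mem]

theorem solidAngle_normalCone_subcone (hu : ∀ i j, ⟪u i, u j⟫ = if i = j then 1 + r else r)
    (hn : 1 + n * r ≠ 0) {k : ℕ} (hk : s.card = k) (hs : 1 + k * r ≠ 0) :
    solidAngle (normalCone (pos u) (subcone u s)) = g (n - k) (r / (1 + k * r)) := by
  subst hk
  have hd := inner_dualVec_univ hu hn
  let e := sᶜ.orderIsoOfFin (by rw [Finset.card_compl, Fintype.card_fin] : sᶜ.card = n - s.card)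
  have he : ∀ i, (e i : Fin n) ∉ s := fun i => Finset.mem_compl.1 (e i).2
  refine solidAngle_eq_g (fun i => dualVec u r s (e i))
    (fun i => dualVec_ne_zero_of_notMem hu hn (he i)) (fun i => ?_) (fun i j => ?_)
    fun z hz => ?_
  · rw [mem_span_normalCone_subcone hd]
    intro l hl
    rw [real_inner_comm, inner_dualVec_of_mem hu hs _ hl, if_neg]
    rintro rfl
    exact he i hl
  · rw [inner_dualVec_dualVec hu hs]
    by_cases hij : i = j
    · subst hij
      simp [equiCov, he]
    · have : (e i : Fin n) ≠ e j := fun h => hij (e.injective (Subtype.ext h))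
      simp [equiCov, hij, this, he]
  · rw [mem_span_normalCone_subcone hd] at hz
    simp_rw [inner_dualVec_of_orthogonal hz]
    rw [normalCone_subcone hd]
    constructor
    · exact fun h i => h.2 _ (he i)
    · refine fun h => ⟨hz, fun j hj => ?_⟩
      simpa using h (e.symm ⟨j, Finset.mem_compl.2 hj⟩)

end Equicorrelated

end ConicVolume

open scoped RealInnerProductSpace in
theorem proposition1p6 (n : ℕ) (hn : 1 ≤ n) (r : ℝ) (hr : -1 / (n : ℝ) < r)
    (N : ℕ) (u : Fin n → EuclideanSpace ℝ (Fin N))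
    (hu : ∀ i j, ⟪u i, u j⟫ = if i = j then 1 + r else r)
    (k : ℕ) (hk : k ≤ n) :
    ConicVolume.conicIntrinsicVolume k (ConicVolume.pos u) = ConicVolume.b n k r := by
  have hn0 := (ConicVolume.one_add_mul_pos hn hr le_rfl).ne'
  have hk0 := (ConicVolume.one_add_mul_pos hn hr hk).ne'
  have hd := ConicVolume.inner_dualVec_univ hu hn0
  rw [ConicVolume.conicIntrinsicVolume, ConicVolume.faces_pos hd,
    finsum_mem_image (ConicVolume.subcone_injective hd).injOn, finsum_mem_coe_finset,
    Finset.sum_congr rfl fun s hs => by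
      have hs' := (Finset.mem_powersetCard.1 hs).2
      rw [ConicVolume.solidAngle_subcone hu hs' hk0,
        ConicVolume.solidAngle_normalCone_subcone hu hn0 hs' hk0],
    Finset.sum_const, Finset.card_powersetCard, Finset.card_univ, Fintype.card_fin, nsmul_eq_mul,
    ConicVolume.b, mul_assoc]
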